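/- Let $k$ be a field and $k[X]=k[x_1,\dots,x_n]$. A \emph{monomial preorder} is a strict partial order $<$ on the monomials $x^a$ ($a\in\mathbb N^n$) for which incomparability is an equivalence relation and for which $x^a<x^b \iff x^ax^c<x^bx^c$ for all $a,b,c\in\mathbb N^n$. It is a \emph{monomial order} if it is total, and it is \emph{global} if for every $i$ either $1<x_i$ or $1$ and $x_i$ are incomparable. For $f=\sum_a c_ax^a\in k[X]$ let $L_<(f)$ be the sum of those terms $c_ax^a$ with $c_a\ne 0$ for which no monomial $x^b$ of $f$ satisfies $x^a<x^b$. Put $S_<=\{u\in k[X] : L_<(u)=1\}$ and $k[X]_<=S_<^{-1}k[X]$. For $f\in k[X]_<$ put $L_<(f):=L_<(uf)$, where $u\in S_<$ is such that $uf\in k[X]$ (this does not depend on $u$). For a subset $G\subseteq k[X]_<$ let $L_<(G)$ be the ideal of $k[X]$ generated by all $L_<(f)$, $f\in G$. A \emph{standard basis} of an ideal $I\subseteq k[X]_<$ with respect to $<$ is a finite subset $G\subseteq I$ with $L_<(G)=L_<(I)$. The \emph{product} $<^*$ of monomial preorders $<$ and $<'$ is defined by: $x^a<^*x^b$ if $x^a<x^b$,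 or if $x^a,x^b$ are incomparable with respect to $<$ and $x^a<'x^b$. \textbf{Theorem.} Let $<$ be a monomial preorder on the monomials of $k[X]$, let $<'$ be a global monomial order, and let $<^*$ be the product of $<$ with $<'$. Then $k[X]_{<^*}=k[X]_<$, and for every ideal $I\subseteq k[X]_<$, every standard basis of $I$ with respect to $<^*$ is also a standard basis of $I$ with respect to $<$. -/

import Mathlib

/-- A monomial preorder on the monomials `x^a`, `a ∈ ℕⁿ`, of a polynomial ring in `n` variables:
a strict weak order that is compatible and cancellative with multiplication.  A monomial is
represented by its exponent vector, so multiplication of monomials is addition of exponents. -/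
structure MonomialPreorder (n : ℕ) where
  /-- `lt a b` means `x^a < x^b`. -/
  lt : (Fin n →₀ ℕ) → (Fin n →₀ ℕ) → Prop
  irrefl : ∀ a, ¬ lt a a
  asymm : ∀ a b, lt a b → ¬ lt b a
  trans : ∀ a b c, lt a b → lt b c → lt a c
  /-- Incomparability is an equivalence relation. -/
  incomp_equivalence : Equivalence fun a b => ¬ lt a b ∧ ¬ lt b a
  compatible : ∀ a b c, lt a b → lt (a + c) (b + c)
  cancellative : ∀ a b c, lt (a + c) (b + c) → lt a b

namespace MonomialPreorder

variable {n : ℕ}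

/-- `x^a` and `x^b` are incomparable. -/
def Incomparable (o : MonomialPreorder n) (a b : Fin n →₀ ℕ) : Prop :=
  ¬ o.lt a b ∧ ¬ o.lt b a

/-- A monomial order is a monomial preorder that is a total order: any two distinct monomials
are comparable. -/
def IsMonomialOrder (o : MonomialPreorder n) : Prop :=
  ∀ a b, a ≠ b → o.lt a b ∨ o.lt b a

/-- A monomial preorder is global if for every variable `x_i`, either `1 < x_i`, or `1` and `x_i`
are incomparable. -/
def IsGlobal (o : MonomialPreorder n) : Prop :=
  ∀ i : Fin n, o.lt 0 (Finsupp.single i 1) ∨ o.Incomparable 0 (Finsupp.single i 1)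

theorem lt_of_lt_of_incomp (o : MonomialPreorder n) {a b c : Fin n →₀ ℕ}
    (h : o.lt a b) (h' : o.Incomparable b c) : o.lt a c := by
  by_contra hac
  by_cases hca : o.lt c a
  · exact h'.2 (o.trans _ _ _ hca h)
  · exact (o.incomp_equivalence.trans ⟨hac, hca⟩ (o.incomp_equivalence.symm h')).1 h

theorem lt_of_incomp_of_lt (o : MonomialPreorder n) {a b c : Fin n →₀ ℕ}
    (h : o.Incomparable a b) (h' : o.lt b c) : o.lt a c := by
  by_contra hac
  by_cases hca : o.lt c a
  · exact h.2 (o.trans _ _ _ h' hca)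
  · exact (o.incomp_equivalence.trans (o.incomp_equivalence.symm h) ⟨hac, hca⟩).1 h'

/-- The product of `o` and `o'`: compare with `o` first, and break ties with `o'`. -/
def prod (o o' : MonomialPreorder n) : MonomialPreorder n where
  lt a b := o.lt a b ∨ (o.Incomparable a b ∧ o'.lt a b)
  irrefl a h := h.elim (o.irrefl a) fun h => o'.irrefl a h.2
  asymm a b h h' := by
    rcases h with h | ⟨h, h1⟩ <;> rcases h' with h' | ⟨h', h1'⟩
    · exact o.asymm _ _ h h'
    · exact h'.2 h
    · exact h.2 h'
    · exact o'.asymm _ _ h1 h1'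
  trans a b c h h' := by
    rcases h with h | ⟨h, h1⟩ <;> rcases h' with h' | ⟨h', h1'⟩
    · exact Or.inl (o.trans _ _ _ h h')
    · exact Or.inl (o.lt_of_lt_of_incomp h h')
    · exact Or.inl (o.lt_of_incomp_of_lt h h')
    · exact Or.inr ⟨o.incomp_equivalence.trans h h', o'.trans _ _ _ h1 h1'⟩
  incomp_equivalence := by
    have key : ∀ a b, (¬ (o.lt a b ∨ (o.Incomparable a b ∧ o'.lt a b)) ∧
        ¬ (o.lt b a ∨ (o.Incomparable b a ∧ o'.lt b a))) ↔
        o.Incomparable a b ∧ o'.Incomparable a b := by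
      intro a b
      unfold Incomparable
      tauto
    refine ⟨fun a => ?_, fun {a b} h => ?_, fun {a b c} h h' => ?_⟩
    · exact (key a a).2 ⟨o.incomp_equivalence.refl a, o'.incomp_equivalence.refl a⟩
    · exact ⟨h.2, h.1⟩
    · have h1 := (key _ _).1 h
      have h2 := (key _ _).1 h'
      exact (key _ _).2 ⟨o.incomp_equivalence.trans h1.1 h2.1,
        o'.incomp_equivalence.trans h1.2 h2.2⟩
  compatible a b c h := by
    rcases h with h | ⟨h, h1⟩
    · exact Or.inl (o.compatible _ _ _ h)
    · exact Or.inr ⟨⟨fun h2 => h.1 (o.cancellative _ _ _ h2),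
        fun h2 => h.2 (o.cancellative _ _ _ h2)⟩, o'.compatible _ _ _ h1⟩
  cancellative a b c h := by
    rcases h with h | ⟨h, h1⟩
    · exact Or.inl (o.cancellative _ _ _ h)
    · exact Or.inr ⟨⟨fun h2 => h.1 (o.compatible _ _ _ h2),
        fun h2 => h.2 (o.compatible _ _ _ h2)⟩, o'.cancellative _ _ _ h1⟩

section LeadingPart

variable {k : Type*} [Field k]

open Classical in
/-- The leading part of a polynomial: the sum of those terms whose monomial is maximal among
the monomials of the polynomial. -/
noncomputable def leadingPart (o : MonomialPreorder n) (f : MvPolynomial (Fin n) k) :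
    MvPolynomial (Fin n) k :=
  ∑ a ∈ f.support with ∀ b ∈ f.support, ¬ o.lt a b, MvPolynomial.monomial a (f.coeff a)

open Classical in
theorem coeff_leadingPart (o : MonomialPreorder n) (f : MvPolynomial (Fin n) k)
    (a : Fin n →₀ ℕ) :
    (o.leadingPart f).coeff a = if ∀ b ∈ f.support, ¬ o.lt a b then f.coeff a else 0 := by
  unfold leadingPart
  rw [MvPolynomial.coeff_sum]
  simp only [MvPolynomial.coeff_monomial, Finset.sum_ite_eq', Finset.mem_filter,
    MvPolynomial.mem_support_iff]
  by_cases h : f.coeff a = 0 <;> simp [h]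

/-- Every monomial of `f` is maximal or lies below a maximal one. -/
theorem exists_max (o : MonomialPreorder n) (f : MvPolynomial (Fin n) k)
    {a : Fin n →₀ ℕ} (ha : a ∈ f.support) :
    ∃ d ∈ f.support, (∀ b ∈ f.support, ¬ o.lt d b) ∧ (a = d ∨ o.lt a d) := by
  classical
  have _ : IsStrictOrder (Fin n →₀ ℕ) (fun x y => o.lt y x) :=
    { irrefl := o.irrefl
      trans := fun _ _ _ h h' => o.trans _ _ _ h' h }
  have wf : (f.support : Set (Fin n →₀ ℕ)).WellFoundedOn (fun x y => o.lt y x) :=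
    Finset.wellFoundedOn f.support
  refine wf.induction (P := fun a => ∃ d ∈ f.support, (∀ b ∈ f.support, ¬ o.lt d b) ∧
    (a = d ∨ o.lt a d)) ha ?_
  · intro a ha ih
    by_cases h : ∀ b ∈ f.support, ¬ o.lt a b
    · exact ⟨a, ha, h, Or.inl rfl⟩
    · push Not at h
      obtain ⟨b, hb, hab⟩ := h
      obtain ⟨d, hd, hmax, hbd⟩ := ih b hb hab
      refine ⟨d, hd, hmax, Or.inr ?_⟩
      rcases hbd with rfl | hbd
      · exact hab
      · exact o.trans _ _ _ hab hbd

theorem leadingPart_one (o : MonomialPreorder n) :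
    o.leadingPart (1 : MvPolynomial (Fin n) k) = 1 := by
  classical
  ext a
  rw [coeff_leadingPart]
  by_cases h : a = 0
  · subst h
    rw [if_pos]
    intro b hb
    have : b = 0 := by
      by_contra hb0
      rw [MvPolynomial.mem_support_iff, MvPolynomial.coeff_one, if_neg (Ne.symm hb0)] at hb
      exact hb rfl
    rw [this]
    exact o.irrefl 0
  · simp [MvPolynomial.coeff_one, Ne.symm h]

/-- Multiplication by a polynomial with leading part `1` does not change the leading part. -/
theorem leadingPart_mul_of_eq_one (o : MonomialPreorder n) {u : MvPolynomial (Fin n) k}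
    (hu : o.leadingPart u = 1) (f : MvPolynomial (Fin n) k) :
    o.leadingPart (u * f) = o.leadingPart f := by
  classical
  have hneg : ∀ c ∈ (u - 1).support, o.lt c 0 := by
    intro c hc
    have h0 : u.coeff 0 = 1 := by
      have := coeff_leadingPart o u 0
      rw [hu, MvPolynomial.coeff_one, if_pos rfl] at this
      split_ifs at this with h
      · exact this.symm
      · exact absurd this one_ne_zero
    have hc0 : c ≠ 0 := by
      rintro rfl
      simp [MvPolynomial.mem_support_iff, h0] at hc
    have hcu : c ∈ u.support := by
      rw [MvPolynomial.mem_support_iff, MvPolynomial.coeff_sub, MvPolynomial.coeff_one,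
        if_neg (Ne.symm hc0), sub_zero] at hc
      rwa [MvPolynomial.mem_support_iff]
    obtain ⟨d, hd, hmax, hcd⟩ := o.exists_max u hcu
    have hd0 : d = 0 := by
      by_contra hd0
      have := coeff_leadingPart o u d
      rw [hu, MvPolynomial.coeff_one, if_neg (Ne.symm hd0), if_pos hmax] at this
      exact (MvPolynomial.mem_support_iff.1 hd) this.symm
    subst hd0
    exact hcd.resolve_left hc0
  have hr : ∀ e, ((u - 1) * f).coeff e ≠ 0 → ∃ d ∈ f.support, o.lt e d := by
    intro e he
    rw [← MvPolynomial.mem_support_iff] at he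
    obtain ⟨c, hc, d, hd, rfl⟩ := Finset.mem_add.1 (MvPolynomial.support_mul _ _ he)
    refine ⟨d, hd, ?_⟩
    simpa using o.compatible c 0 d (hneg c hc)
  have hsum : ∀ e, (u * f).coeff e = f.coeff e + ((u - 1) * f).coeff e := by
    intro e
    rw [← MvPolynomial.coeff_add]
    congr 1
    ring
  have hmaxcoeff : ∀ e, (∀ b ∈ f.support, ¬ o.lt e b) → (u * f).coeff e = f.coeff e := by
    intro e he
    rw [hsum]
    by_cases h : ((u - 1) * f).coeff e = 0
    · rw [h, add_zero]
    · obtain ⟨d, hd, hlt⟩ := hr e h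
      exact absurd hlt (he d hd)
  have hbelow : ∀ a ∈ (u * f).support, ∃ d ∈ f.support, a = d ∨ o.lt a d := by
    intro a ha
    by_cases h : f.coeff a = 0
    · rw [MvPolynomial.mem_support_iff, hsum, h, zero_add] at ha
      obtain ⟨d, hd, hlt⟩ := hr a ha
      exact ⟨d, hd, Or.inr hlt⟩
    · exact ⟨a, MvPolynomial.mem_support_iff.2 h, Or.inl rfl⟩
  ext e
  rw [coeff_leadingPart, coeff_leadingPart]
  by_cases he : ∀ b ∈ f.support, ¬ o.lt e b
  · rw [if_pos he, if_pos, hmaxcoeff e he]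
    intro a ha hea
    obtain ⟨d, hd, rfl | had⟩ := hbelow a ha
    · exact he _ hd hea
    · exact he d hd (o.trans _ _ _ hea had)
  · rw [if_neg he, if_neg]
    push Not at he ⊢
    obtain ⟨b, hb, heb⟩ := he
    obtain ⟨d, hd, hmax, hbd⟩ := o.exists_max f hb
    refine ⟨d, ?_, ?_⟩
    · rw [MvPolynomial.mem_support_iff, hmaxcoeff d hmax]
      exact MvPolynomial.mem_support_iff.1 hd
    · rcases hbd with rfl | hbd
      · exact heb
      · exact o.trans _ _ _ heb hbd

end LeadingPart

/-- The multiplicative set `S_<` of all polynomials with leading part `1`.  The ring `k[X]_<` is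
the localization of `k[X]` at this set. -/
def unitMonoid (o : MonomialPreorder n) (k : Type*) [Field k] :
    Submonoid (MvPolynomial (Fin n) k) where
  carrier := {u | o.leadingPart u = 1}
  one_mem' := o.leadingPart_one
  mul_mem' {u v} hu hv := by
    change o.leadingPart (u * v) = 1
    rw [o.leadingPart_mul_of_eq_one hu]
    exact hv

section Localization

variable {k : Type*} [Field k] {R : Type*} [CommRing R] [Algebra (MvPolynomial (Fin n) k) R]

/-- The leading part of an element `f` of `R = k[X]_<`: write `u f = p` with `u ∈ S_<` and
`p ∈ k[X]`, and take the leading part of `p`.  By `locLeadingPart_eq` the choice of `u` does not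
matter. -/
noncomputable def locLeadingPart (o : MonomialPreorder n) [IsLocalization (o.unitMonoid k) R]
    (f : R) : MvPolynomial (Fin n) k :=
  o.leadingPart (IsLocalization.sec (o.unitMonoid k) f).1

theorem locLeadingPart_eq (o : MonomialPreorder n) [IsLocalization (o.unitMonoid k) R]
    (f : R) (u p : MvPolynomial (Fin n) k) (hu : o.leadingPart u = 1)
    (h : algebraMap (MvPolynomial (Fin n) k) R u * f = algebraMap (MvPolynomial (Fin n) k) R p) :
    o.locLeadingPart f = o.leadingPart p := by
  unfold locLeadingPart
  have hs := IsLocalization.sec_spec (o.unitMonoid k) f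
  set s := IsLocalization.sec (o.unitMonoid k) f
  have hs2 : o.leadingPart (s.2 : MvPolynomial (Fin n) k) = 1 := s.2.2
  have heq : algebraMap (MvPolynomial (Fin n) k) R (u * s.1) =
      algebraMap (MvPolynomial (Fin n) k) R (s.2 * p) := by
    rw [map_mul, map_mul, ← hs, ← h]
    ring
  obtain ⟨c, hc⟩ := (IsLocalization.eq_iff_exists (o.unitMonoid k) R).1 heq
  have hc1 : o.leadingPart (c : MvPolynomial (Fin n) k) = 1 := c.2
  have := congrArg o.leadingPart hc
  rwa [o.leadingPart_mul_of_eq_one hc1, o.leadingPart_mul_of_eq_one hc1,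
    o.leadingPart_mul_of_eq_one hu, o.leadingPart_mul_of_eq_one hs2] at this

/-- The leading ideal of a subset `G` of `R = k[X]_<`: the ideal of `k[X]` generated by the
leading parts of the elements of `G`. -/
noncomputable def leadingIdeal (o : MonomialPreorder n) [IsLocalization (o.unitMonoid k) R]
    (G : Set R) : Ideal (MvPolynomial (Fin n) k) :=
  Ideal.span (o.locLeadingPart '' G)

/-- A finite subset `G` of an ideal `I` of `R = k[X]_<` is a standard basis of `I` if it has the
same leading ideal as `I`. -/
def IsStandardBasis (o : MonomialPreorder n) (k : Type*) [Field k] {R : Type*} [CommRing R]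
    [Algebra (MvPolynomial (Fin n) k) R] [IsLocalization (o.unitMonoid k) R]
    (I : Ideal R) (G : Set R) : Prop :=
  G.Finite ∧ G ⊆ (I : Set R) ∧
    (o.leadingIdeal G : Ideal (MvPolynomial (Fin n) k)) = o.leadingIdeal (I : Set R)

end Localization

end MonomialPreorder

/-! Since `o'` is total, so is `<*`, and every nonzero `g` has a largest monomial `x^m` for `<*`.
The `<`-leading part of `g` is the part of `g` in the `<`-incomparability class of `x^m`.

Let `g` be a polynomial in `I`. As `G` is a standard basis for `<*`, `x^m` is divisible by the
`<*`-leading monomial of some `p`, an element of `G` with its denominator cleared. Subtracting the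
multiple `q` of `p` that cancels the top term gives `L(g) = L(q)` if the class of `x^m` vanishes in
`g - q`, and `L(g) = L(q) + L(g - q)` otherwise. In the second case the top of `g - q` stays in that
class and drops for `o'`, so well-founded induction on `o'` finishes (`leadingPart_mem_of_isTop`).
The order `<*` itself need not be well-founded.

Both orders have the same unit set (`unitMonoid_prod`), so one denominator serves both. -/

namespace MonomialPreorder

variable {n : ℕ} {k : Type*} [Field k]

/-! ### Unit sets, and global orders as well-orders -/

theorem leadingPart_eq_one_iff (o : MonomialPreorder n) (u : MvPolynomial (Fin n) k) :
    o.leadingPart u = 1 ↔ u.coeff 0 = 1 ∧ ∀ c ∈ u.support, c ≠ 0 → o.lt c 0 := by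
  classical
  constructor
  · intro hu
    have h0 : u.coeff 0 = 1 := by
      have := coeff_leadingPart o u 0
      rw [hu, MvPolynomial.coeff_one, if_pos rfl] at this
      split_ifs at this with h
      · exact this.symm
      · exact absurd this one_ne_zero
    refine ⟨h0, fun c hc hc0 => ?_⟩
    obtain ⟨d, hd, hmax, hcd⟩ := o.exists_max u hc
    have hd0 : d = 0 := by
      by_contra hd0
      have := coeff_leadingPart o u d
      rw [hu, MvPolynomial.coeff_one, if_neg (Ne.symm hd0), if_pos hmax] at this
      exact (MvPolynomial.mem_support_iff.1 hd) this.symm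
    subst hd0
    exact hcd.resolve_left hc0
  · rintro ⟨h0, h⟩
    have hs : (0 : Fin n →₀ ℕ) ∈ u.support := by
      rw [MvPolynomial.mem_support_iff, h0]
      exact one_ne_zero
    ext a
    rw [coeff_leadingPart, MvPolynomial.coeff_one]
    by_cases ha : a = 0
    · subst ha
      rw [if_pos, if_pos rfl, h0]
      intro b hb hlt
      by_cases hb0 : b = 0
      · exact o.irrefl 0 (hb0 ▸ hlt)
      · exact o.asymm _ _ hlt (h b hb hb0)
    · rw [if_neg (Ne.symm ha)]
      split_ifs with hmax
      · by_contra hne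
        exact hmax 0 hs (h a (MvPolynomial.mem_support_iff.2 hne) ha)
      · rfl

/-- Totality excludes that `1` and `x_i` are incomparable, so `1 < x_i`; compatibility extends this
to products. -/
theorem IsMonomialOrder.zero_lt {o : MonomialPreorder n} (h : o.IsMonomialOrder)
    (hg : o.IsGlobal) {a : Fin n →₀ ℕ} (ha : a ≠ 0) : o.lt 0 a := by
  have hvar : ∀ i : Fin n, o.lt 0 (Finsupp.single i 1) := fun i =>
    (hg i).elim id fun hi => absurd (h 0 (Finsupp.single i 1) (Finsupp.single_ne_zero.2 one_ne_zero).symm) (by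
      rintro (h1 | h1)
      · exact hi.1 h1
      · exact hi.2 h1)
  have key : ∀ a : Fin n →₀ ℕ, a = 0 ∨ o.lt 0 a := by
    intro a
    induction a using Finsupp.induction_linear with
    | zero => exact Or.inl rfl
    | add f g hf hf' =>
      rcases hf with rfl | hf
      · simpa using hf'
      rcases hf' with rfl | hf'
      · simpa using Or.inr hf
      · exact Or.inr (o.trans _ _ _ hf' (by simpa using o.compatible _ _ g hf))
    | single i m =>
      induction m with
      | zero => simp
      | succ m ih =>
        right
        rw [Finsupp.single_add]
        rcases ih with ih | ih
        · rw [ih, zero_add]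
          exact hvar i
        · exact o.trans _ _ _ (hvar i) (by simpa using o.compatible _ _ (Finsupp.single i 1) ih)
  exact (key a).resolve_left ha

theorem IsMonomialOrder.wellFounded {o : MonomialPreorder n} (h : o.IsMonomialOrder)
    (hg : o.IsGlobal) : WellFounded o.lt := by
  have : IsStrictOrder (Fin n →₀ ℕ) o.lt :=
    { irrefl := o.irrefl
      trans := fun _ _ _ => o.trans _ _ _ }
  rw [RelEmbedding.wellFounded_iff_isEmpty]
  refine ⟨fun f => ?_⟩
  -- Dickson's lemma: in an infinite descending sequence some term divides a later one, hence cannot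
  -- exceed it.
  obtain ⟨i, j, hij, hle⟩ := wellQuasiOrdered_le (α := Fin n →₀ ℕ) f
  have hlt : o.lt (f j) (f i) := f.map_rel_iff.2 hij
  obtain ⟨c, hc⟩ := exists_add_of_le hle
  by_cases hc0 : c = 0
  · rw [hc, hc0, add_zero] at hlt
    exact o.irrefl _ hlt
  · have := o.compatible _ _ (f i) (h.zero_lt hg hc0)
    rw [zero_add, add_comm, ← hc] at this
    exact o.asymm _ _ hlt this

theorem prod_isMonomialOrder (o : MonomialPreorder n) {o' : MonomialPreorder n}
    (h : o'.IsMonomialOrder) : (o.prod o').IsMonomialOrder := by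
  intro a b hab
  by_cases h1 : o.lt a b
  · exact Or.inl (Or.inl h1)
  by_cases h2 : o.lt b a
  · exact Or.inr (Or.inl h2)
  exact (h a b hab).imp (fun h3 => Or.inr ⟨⟨h1, h2⟩, h3⟩) fun h3 => Or.inr ⟨⟨h2, h1⟩, h3⟩

/-- The tie-break adds no monomial below `1`, because `1` is the least monomial for `o'`. -/
theorem unitMonoid_prod (o : MonomialPreorder n) {o' : MonomialPreorder n}
    (hg : o'.IsGlobal) (h : o'.IsMonomialOrder) :
    (o.prod o').unitMonoid k = o.unitMonoid k := by
  ext u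
  change (o.prod o').leadingPart u = 1 ↔ o.leadingPart u = 1
  rw [leadingPart_eq_one_iff, leadingPart_eq_one_iff]
  refine and_congr_right fun _ => forall₃_congr fun c _ hc => ⟨fun hlt => ?_, Or.inl⟩
  rcases hlt with hlt | ⟨-, hlt⟩
  · exact hlt
  · exact absurd (h.zero_lt hg hc) (o'.asymm _ _ hlt)

/-! ### Largest monomials and leading parts -/

/-- `x^m` is the largest monomial of `f`. -/
def IsTop (o : MonomialPreorder n) (f : MvPolynomial (Fin n) k) (m : Fin n →₀ ℕ) : Prop :=
  m ∈ f.support ∧ ∀ b ∈ f.support, b ≠ m → o.lt b m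

theorem IsTop.not_lt {o : MonomialPreorder n} {f : MvPolynomial (Fin n) k} {m : Fin n →₀ ℕ}
    (h : o.IsTop f m) {b : Fin n →₀ ℕ} (hb : b ∈ f.support) : ¬ o.lt m b := by
  intro hlt
  by_cases hbm : b = m
  · exact o.irrefl m (hbm ▸ hlt)
  · exact o.asymm _ _ hlt (h.2 b hb hbm)

theorem IsMonomialOrder.exists_isTop {o : MonomialPreorder n} (h : o.IsMonomialOrder)
    {f : MvPolynomial (Fin n) k} (hf : f ≠ 0) : ∃ m, o.IsTop f m := by
  obtain ⟨a, ha⟩ := MvPolynomial.support_nonempty.2 hf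
  obtain ⟨m, hm, hmax, -⟩ := o.exists_max f ha
  exact ⟨m, hm, fun b hb hbm => (h b m hbm).resolve_right (hmax b hb)⟩

theorem IsTop.leadingPart_eq {o : MonomialPreorder n} {f : MvPolynomial (Fin n) k}
    {m : Fin n →₀ ℕ} (h : o.IsTop f m) :
    o.leadingPart f = MvPolynomial.monomial m (f.coeff m) := by
  classical
  ext a
  rw [coeff_leadingPart, MvPolynomial.coeff_monomial]
  by_cases ham : m = a
  · subst ham
    rw [if_pos fun b hb => h.not_lt hb, if_pos rfl]
  · rw [if_neg ham]
    split_ifs with hmax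
    · by_contra hne
      exact hmax m h.1 (h.2 a (MvPolynomial.mem_support_iff.2 hne) (Ne.symm ham))
    · rfl

open Classical in
/-- If `x^d` is maximal for `f` and incomparable to some monomial of `f`, then the leading part
of `f` collects the terms that are incomparable to `x^d`. -/
theorem coeff_leadingPart_of_incomparable (o : MonomialPreorder n) {f : MvPolynomial (Fin n) k}
    {d d' : Fin n →₀ ℕ} (hd' : d' ∈ f.support) (hdd' : o.Incomparable d' d)
    (hmax : ∀ b ∈ f.support, ¬ o.lt d b) (a : Fin n →₀ ℕ) :
    (o.leadingPart f).coeff a = if o.Incomparable a d then f.coeff a else 0 := by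
  rw [coeff_leadingPart]
  by_cases ha : f.coeff a = 0
  · simp [ha]
  have ha' := MvPolynomial.mem_support_iff.2 ha
  refine if_congr ⟨fun h => ⟨fun hlt => ?_, hmax a ha'⟩, fun h b hb hlt => ?_⟩ rfl rfl
  · exact h d' hd' (o.lt_of_lt_of_incomp hlt ⟨hdd'.2, hdd'.1⟩)
  · exact hmax b hb (o.lt_of_incomp_of_lt ⟨h.2, h.1⟩ hlt)

theorem incomparable_add_iff (o : MonomialPreorder n) (a b c : Fin n →₀ ℕ) :
    o.Incomparable (a + c) (b + c) ↔ o.Incomparable a b :=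
  and_congr (not_congr ⟨o.cancellative a b c, o.compatible a b c⟩)
    (not_congr ⟨o.cancellative b a c, o.compatible b a c⟩)

theorem IsTop.monomial_mul {o : MonomialPreorder n} {f : MvPolynomial (Fin n) k}
    {m : Fin n →₀ ℕ} (h : o.IsTop f m) (s : Fin n →₀ ℕ) {r : k} (hr : r ≠ 0) :
    o.IsTop (MvPolynomial.monomial s r * f) (m + s) := by
  refine ⟨?_, fun b hb hbm => ?_⟩
  · rw [MvPolynomial.mem_support_iff, add_comm, MvPolynomial.coeff_monomial_mul]
    exact mul_ne_zero hr (MvPolynomial.mem_support_iff.1 h.1)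
  · rw [MvPolynomial.mem_support_iff, MvPolynomial.coeff_monomial_mul'] at hb
    split_ifs at hb with hsb
    · obtain ⟨c, rfl⟩ := exists_add_of_le hsb
      rw [add_tsub_cancel_left] at hb
      rw [add_comm s c] at hbm ⊢
      exact o.compatible _ _ _ (h.2 c (MvPolynomial.mem_support_iff.2 (right_ne_zero_of_mul hb))
        fun hcm => hbm (by rw [hcm]))
    · exact absurd rfl hb

/-- Translation by `s` both preserves and reflects `<`, hence maximality of a monomial. -/
theorem leadingPart_monomial_mul (o : MonomialPreorder n) (f : MvPolynomial (Fin n) k)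
    (s : Fin n →₀ ℕ) {r : k} (hr : r ≠ 0) :
    o.leadingPart (MvPolynomial.monomial s r * f) =
      MvPolynomial.monomial s r * o.leadingPart f := by
  classical
  have hsupp : ∀ b, s + b ∈ (MvPolynomial.monomial s r * f).support ↔ b ∈ f.support := by
    intro b
    simp [MvPolynomial.mem_support_iff, MvPolynomial.coeff_monomial_mul, hr]
  ext e
  rw [coeff_leadingPart, MvPolynomial.coeff_monomial_mul', MvPolynomial.coeff_monomial_mul']
  by_cases hse : s ≤ e
  · obtain ⟨c, rfl⟩ := exists_add_of_le hse
    rw [if_pos hse, if_pos hse, add_tsub_cancel_left, coeff_leadingPart, mul_ite, mul_zero]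
    refine if_congr ⟨fun h b hb hlt => ?_, fun h b hb hlt => ?_⟩ rfl rfl
    · refine h (s + b) ((hsupp b).2 hb) ?_
      rw [add_comm s c, add_comm s b]
      exact o.compatible _ _ _ hlt
    · have hsb : s ≤ b := by
        by_contra hsb
        rw [MvPolynomial.mem_support_iff, MvPolynomial.coeff_monomial_mul', if_neg hsb] at hb
        exact hb rfl
      obtain ⟨b, rfl⟩ := exists_add_of_le hsb
      rw [add_comm s c, add_comm s b] at hlt
      exact h b ((hsupp b).1 hb) (o.cancellative _ _ _ hlt)
  · simp [hse]

/-! ### Reduction by leading terms -/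

theorem IsTop.incomparable_max {o o' : MonomialPreorder n} {f : MvPolynomial (Fin n) k}
    {m : Fin n →₀ ℕ} (h : (o.prod o').IsTop f m) {b : Fin n →₀ ℕ} (hb : b ∈ f.support) :
    ¬ o.lt m b := fun hlt => h.not_lt hb (Or.inl hlt)

/-- If every element of `I` has its `<*`-leading monomial divisible by that of some `p ∈ I` with
`<`-leading part in `J`, then all `<`-leading parts of elements of `I` lie in `J`. -/
theorem leadingPart_mem_of_isTop {o o' : MonomialPreorder n} (hg : o'.IsGlobal)
    (h : o'.IsMonomialOrder) {I J : Ideal (MvPolynomial (Fin n) k)}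
    (hI : ∀ g ∈ I, ∀ m, (o.prod o').IsTop g m →
      ∃ p ∈ I, ∃ a ≤ m, (o.prod o').IsTop p a ∧ o.leadingPart p ∈ J)
    (m : Fin n →₀ ℕ) : ∀ g ∈ I, (o.prod o').IsTop g m → o.leadingPart g ∈ J := by
  classical
  induction m using (h.wellFounded hg).induction with
  | _ m ih =>
  intro g hgI hm
  obtain ⟨p, hp, a, ham, ha, hpJ⟩ := hI g hgI m hm
  obtain ⟨s, rfl⟩ := exists_add_of_le ham
  have hpa := MvPolynomial.mem_support_iff.1 ha.1
  set r := g.coeff (a + s) / p.coeff a with hr_def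
  have hr : r ≠ 0 := div_ne_zero (MvPolynomial.mem_support_iff.1 hm.1) hpa
  set q := MvPolynomial.monomial s r * p with hq_def
  have hq : (o.prod o').IsTop q (a + s) := ha.monomial_mul s hr
  have hqJ : o.leadingPart q ∈ J := by
    rw [hq_def, leadingPart_monomial_mul o p s hr]
    exact J.mul_mem_left _ hpJ
  have hcoeff : (g - q).coeff (a + s) = 0 := by
    rw [MvPolynomial.coeff_sub, hq_def, add_comm a s, MvPolynomial.coeff_monomial_mul, hr_def,
      div_mul_cancel₀ _ hpa, add_comm, sub_self]
  have hbelow : ∀ b ∈ (g - q).support, (o.prod o').lt b (a + s) := by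
    intro b hb
    have hbm : b ≠ a + s := by
      rintro rfl
      exact MvPolynomial.mem_support_iff.1 hb hcoeff
    rcases Finset.mem_union.1 (MvPolynomial.support_sub _ g q hb) with hb | hb
    · exact hm.2 b hb hbm
    · exact hq.2 b hb hbm
  have hrefl := o.incomp_equivalence.refl (a + s)
  have hgc := o.coeff_leadingPart_of_incomparable hm.1 hrefl fun b => hm.incomparable_max
  have hqc := o.coeff_leadingPart_of_incomparable hq.1 hrefl fun b => hq.incomparable_max
  by_cases hex : ∃ b ∈ (g - q).support, o.Incomparable b (a + s)
  · obtain ⟨b, hb, hbm⟩ := hex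
    obtain ⟨d, hd⟩ := (o.prod_isMonomialOrder h).exists_isTop (f := g - q)
      (MvPolynomial.support_nonempty.1 ⟨b, hb⟩)
    -- If `d` were `<`-below `a + s`, it would be `<`-below `b` too, against its being the top.
    have hdm : o.Incomparable d (a + s) ∧ o'.lt d (a + s) := by
      rcases hbelow d hd.1 with hlt | hlt
      · exact absurd (o.lt_of_lt_of_incomp hlt ⟨hbm.2, hbm.1⟩) (hd.incomparable_max hb)
      · exact hlt
    have hsub := ih d hdm.2 (g - q) (I.sub_mem hgI (I.mul_mem_left _ hp)) hd
    -- The reference monomial `a + s` was cancelled from `g - q`; `d` witnesses that its class is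
    -- still met. All three leading parts are thus cut out by one class.
    have hdc := o.coeff_leadingPart_of_incomparable hd.1 hdm.1 fun b hb hlt =>
      (o.prod o').asymm _ _ (hbelow b hb) (Or.inl hlt)
    have : o.leadingPart g = o.leadingPart q + o.leadingPart (g - q) := by
      ext e
      rw [MvPolynomial.coeff_add, hgc, hqc, hdc, MvPolynomial.coeff_sub]
      split_ifs <;> simp
    rw [this]
    exact J.add_mem hqJ hsub
  · have : o.leadingPart g = o.leadingPart q := by
      ext e
      rw [hgc, hqc]
      split_ifs with he
      · by_contra hne
        refine hex ⟨e, ?_, he⟩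
        rw [MvPolynomial.mem_support_iff, MvPolynomial.coeff_sub]
        exact sub_ne_zero.2 hne
      · rfl
    rw [this]
    exact hqJ

end MonomialPreorder

/-! ### Passage to the localization -/

theorem mainTheorem3 {k : Type*} [Field k] {n : ℕ} (o o' : MonomialPreorder n)
    (hglobal : o'.IsGlobal) (horder : o'.IsMonomialOrder)
    {R : Type*} [CommRing R] [Algebra (MvPolynomial (Fin n) k) R]
    [IsLocalization (o.unitMonoid k) R] :
    ∃ _ : IsLocalization ((o.prod o').unitMonoid k) R,
      ∀ (I : Ideal R) (G : Set R),
        (o.prod o').IsStandardBasis k I G → o.IsStandardBasis k I G := by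
  have hS : (o.prod o').unitMonoid k = o.unitMonoid k := o.unitMonoid_prod hglobal horder
  have hloc : IsLocalization ((o.prod o').unitMonoid k) R := by
    rw [hS]
    infer_instance
  refine ⟨hloc, fun I G ⟨hfin, hsub, heq⟩ => ⟨hfin, hsub, le_antisymm ?_ ?_⟩⟩
  · exact Ideal.span_mono (Set.image_mono hsub)
  -- The same numerator `p` computes both leading parts of `f`.
  have hrep : ∀ f ∈ I, ∃ p ∈ I.comap (algebraMap (MvPolynomial (Fin n) k) R),
      o.locLeadingPart f = o.leadingPart p ∧
        (o.prod o').locLeadingPart f = (o.prod o').leadingPart p := by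
    intro f hf
    obtain ⟨⟨p, u⟩, hpu⟩ := IsLocalization.surj (o.unitMonoid k) f
    have hpu' : algebraMap (MvPolynomial (Fin n) k) R u * f = algebraMap _ R p := by
      rw [mul_comm]
      exact hpu
    have hu : o.leadingPart (u : MvPolynomial (Fin n) k) = 1 := u.2
    have hu' : (u : MvPolynomial (Fin n) k) ∈ (o.prod o').unitMonoid k := by
      rw [hS]
      exact hu
    refine ⟨p, ?_, o.locLeadingPart_eq f (u : MvPolynomial (Fin n) k) p hu hpu',
      (o.prod o').locLeadingPart_eq f (u : MvPolynomial (Fin n) k) p hu' hpu'⟩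
    rw [Ideal.mem_comap, ← hpu']
    exact I.mul_mem_left _ hf
  have hprod := o.prod_isMonomialOrder horder
  refine Ideal.span_le.2 ?_
  rintro _ ⟨f, hf, rfl⟩
  obtain ⟨g, hgI, hfg, -⟩ := hrep f hf
  rw [SetLike.mem_coe, hfg]
  by_cases hg0 : g = 0
  · rw [hg0]
    simp [MonomialPreorder.leadingPart]
  obtain ⟨m, hm⟩ := hprod.exists_isTop hg0
  refine MonomialPreorder.leadingPart_mem_of_isTop hglobal horder ?_ m g hgI hm
  intro g hgI m hm
  have hmem : (o.prod o').leadingPart g ∈ (o.prod o').leadingIdeal G := by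
    rw [heq]
    refine Ideal.subset_span ⟨algebraMap _ R g, hgI, ?_⟩
    exact (o.prod o').locLeadingPart_eq _ 1 g (o.prod o').leadingPart_one (by simp)
  -- The `<*`-leading parts of `G` are single terms or zero, so they lie in a monomial ideal, where
  -- membership is divisibility; each generator remembers its `p`.
  have hle : (o.prod o').leadingIdeal G ≤
      Ideal.span ((fun a => MvPolynomial.monomial a (1 : k)) ''
        {a | ∃ p ∈ I.comap (algebraMap (MvPolynomial (Fin n) k) R),
          (o.prod o').IsTop p a ∧ o.leadingPart p ∈ o.leadingIdeal G}) := by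
    refine Ideal.span_le.2 ?_
    rintro _ ⟨γ, hγ, rfl⟩
    obtain ⟨p, hpI, hp, hp'⟩ := hrep γ (hsub hγ)
    rw [SetLike.mem_coe, hp']
    by_cases hp0 : p = 0
    · rw [hp0]
      simp [MonomialPreorder.leadingPart]
    obtain ⟨a, ha⟩ := hprod.exists_isTop hp0
    rw [ha.leadingPart_eq, ← mul_one (p.coeff a), ← MvPolynomial.C_mul_monomial]
    refine Ideal.mul_mem_left _ _ (Ideal.subset_span ⟨a, ⟨p, hpI, ha, ?_⟩, rfl⟩)
    rw [← hp]
    exact Ideal.subset_span ⟨γ, hγ, rfl⟩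
  have := MvPolynomial.mem_ideal_span_monomial_image.1 (hle hmem) m (by
    rw [hm.leadingPart_eq, MvPolynomial.mem_support_iff, MvPolynomial.coeff_monomial, if_pos rfl]
    exact MvPolynomial.mem_support_iff.1 hm.1)
  obtain ⟨a, ⟨p, hpI, ha, hpJ⟩, ham⟩ := this
  exact ⟨p, hpI, a, ham, ha, hpJ⟩
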